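/- Call a function $F:\mathbb R^\nu\to\mathbb R$ almost periodic (in $\nu$ variables) if it belongs to the closure, in the uniform norm on $\mathbb R^\nu$, of the real algebra of functions generated by $x\mapsto\cos(\lambda x_j)$ and $x\mapsto\sin(\lambda x_j)$, $\lambda\in\mathbb R$, $1\le j\le\nu$; call $f:\mathbb R\to\mathbb R$ almost periodic if it is the uniform limit on $\mathbb R$ of generalized trigonometric polynomials $\sum_{k=1}^N\bigl(a_k\cos(\lambda_kx)+b_k\sin(\lambda_kx)\bigr)$ with real $a_k,b_k,\lambda_k$. A real sequence $(u_n)_{n\ge1}$ is dense in $[0,1)$ (mod 1) if the fractional parts of the $u_n$, $n\ge 1$, are dense in $[0,1)$. Let $P_0,P_1,\dots,P_\nu$ be polynomials in one variable with real coefficients and without constant term, and assume that $P_0$ has at least one irrational coefficient. Then: (i) for every almost periodic function $F$ of $\nu$ variables, the sequence $\bigl(P_0(n)+F(P_1(n),\dots,P_\nu(n))\bigr)_{n=1}^\infty$ is dense in $[0,1)$ (mod 1); (ii) for all almost periodic functions $f_1,\dots,f_\nu:\mathbb R\to\mathbb R$, the sequence $\bigl(P_0(n)+\sum_{j=1}^\nu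 f_j(P_j(n))\bigr)_{n=1}^\infty$ is dense in $[0,1)$ (mod 1). -/

import Mathlib

open Polynomial

/-- The functions `x ↦ cos (l * x_j)` and `x ↦ sin (l * x_j)` on `ℝ^ν`, with `l` real. -/
def trigMonomials (ν : ℕ) : Set ((Fin ν → ℝ) → ℝ) :=
  {g | ∃ (j : Fin ν) (l : ℝ),
    g = (fun x => Real.cos (l * x j)) ∨ g = (fun x => Real.sin (l * x j))}

/-- Almost periodic functions of `ν` variables: the closure, in the uniform norm on `ℝ^ν`, of the
real algebra generated by the functions `cos (l * x_j)` and `sin (l * x_j)`. -/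
def IsAlmostPeriodic {ν : ℕ} (F : (Fin ν → ℝ) → ℝ) : Prop :=
  ∀ ε : ℝ, 0 < ε → ∃ T ∈ Algebra.adjoin ℝ (trigMonomials ν), ∀ x, |F x - T x| ≤ ε

/-- Almost periodic functions of one real variable: uniform limits on `ℝ` of generalized real
trigonometric polynomials (arbitrary real frequencies). -/
def IsAlmostPeriodicOneVar (f : ℝ → ℝ) : Prop :=
  ∀ ε : ℝ, 0 < ε → ∃ (N : ℕ) (a b l : Fin N → ℝ), ∀ x,
    |f x - ∑ k, (a k * Real.cos (l k * x) + b k * Real.sin (l k * x))| ≤ ε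

/-- The sequence `u 1, u 2, …` is dense in `[0, 1)` mod 1: its fractional parts are dense there. -/
def DenseModOne (u : ℕ → ℝ) : Prop :=
  Set.Ico (0 : ℝ) 1 ⊆ closure ((fun n => Int.fract (u n)) '' {n : ℕ | 1 ≤ n})

open Filter Topology ComplexConjugate

/-! Fix a `ℚ`-linear projection `f : ℝ → ℚ` and split each coefficient `c` into `f c` and `c - f c`.
At multiples `n` of a common denominator the rational part of a polynomial is an integer, so modulo
one only the irrational part counts. An integer combination of irrational parts is zero or has
irrational leading coefficient, so Weyl's theorem (`tendsto_cesaroMean_expTwoPi`) and Fourier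
analysis on the torus (`mem_closure_range_of_mFourier`) show that their values at such `n` come
close, modulo one, to their values at any real `t` (`eval_mem_closure_range`). Since `cos (c *
P_j(n))` depends only on `c / (2π) * P_j(n)` modulo one, `P₀(n) + T(P(n))`, for `T` a trigonometric
polynomial, accumulates modulo one at `R(t) + G(t)`, where `R` is the irrational part of `P₀` and
`G` is bounded and continuous. As `R` is nonconstant, the intermediate value theorem gives every
residue (`exists_eval_add_eq_add_int`). Part (ii) is (i) for a sum of functions of single
coordinates. -/

/-! ### Cesàro means and van der Corput's difference theorem -/

/-- The mean of the first `N` terms of a complex sequence. -/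
noncomputable def cesaroMean (z : ℕ → ℂ) (N : ℕ) : ℂ := (N : ℂ)⁻¹ * ∑ n ∈ Finset.range N, z n

theorem cesaroMean_zero : cesaroMean (fun _ => 0) = fun _ => 0 := by
  ext N; simp [cesaroMean]

theorem cesaroMean_add (z w : ℕ → ℂ) (N : ℕ) :
    cesaroMean (fun n => z n + w n) N = cesaroMean z N + cesaroMean w N := by
  simp [cesaroMean, Finset.sum_add_distrib, mul_add]

theorem cesaroMean_sub (z w : ℕ → ℂ) (N : ℕ) :
    cesaroMean (fun n => z n - w n) N = cesaroMean z N - cesaroMean w N := by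
  simp [cesaroMean, Finset.sum_sub_distrib, mul_sub]

theorem cesaroMean_const_mul (c : ℂ) (z : ℕ → ℂ) (N : ℕ) :
    cesaroMean (fun n => c * z n) N = c * cesaroMean z N := by
  simp only [cesaroMean, ← Finset.mul_sum]; ring

theorem cesaroMean_finset_sum {ι : Type*} (s : Finset ι) (z : ι → ℕ → ℂ) (N : ℕ) :
    cesaroMean (fun n => ∑ i ∈ s, z i n) N = ∑ i ∈ s, cesaroMean (z i) N := by
  simp only [cesaroMean]
  rw [Finset.sum_comm, Finset.mul_sum]

theorem cesaroMean_conj (z : ℕ → ℂ) (N : ℕ) :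
    cesaroMean (fun n => conj (z n)) N = conj (cesaroMean z N) := by
  simp [cesaroMean, map_sum]

theorem norm_cesaroMean_le {z : ℕ → ℂ} {C : ℝ} (hC : 0 ≤ C) (hz : ∀ n, ‖z n‖ ≤ C) (N : ℕ) :
    ‖cesaroMean z N‖ ≤ C := by
  rw [cesaroMean, norm_mul, norm_inv, Complex.norm_natCast]
  have h : ‖∑ n ∈ Finset.range N, z n‖ ≤ N * C := by
    simpa using norm_sum_le_of_le (Finset.range N) (fun n _ => hz n)
  rcases Nat.eq_zero_or_pos N with rfl | hN
  · simpa using hC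
  · have hN' : (0 : ℝ) < N := by exact_mod_cast hN
    rw [inv_mul_le_iff₀ hN']
    exact h

theorem norm_cesaroMean_sq_le (z : ℕ → ℂ) (N : ℕ) :
    ‖cesaroMean z N‖ ^ 2 ≤ ‖cesaroMean (fun n => z n * conj (z n)) N‖ := by
  rcases Nat.eq_zero_or_pos N with rfl | hN
  · simp [cesaroMean]
  have hN' : (0 : ℝ) < N := by exact_mod_cast hN
  have h1 : ∑ n ∈ Finset.range N, z n * conj (z n)
      = ((∑ n ∈ Finset.range N, ‖z n‖ ^ 2 : ℝ) : ℂ) := by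
    push_cast
    exact Finset.sum_congr rfl fun n _ => Complex.mul_conj' (z n)
  simp only [cesaroMean]
  rw [h1, norm_mul, norm_mul, norm_inv, Complex.norm_natCast, Complex.norm_real,
    Real.norm_of_nonneg (Finset.sum_nonneg fun n _ => sq_nonneg _), mul_pow]
  have h2 : ‖∑ n ∈ Finset.range N, z n‖ ^ 2 ≤ N * ∑ n ∈ Finset.range N, ‖z n‖ ^ 2 := by
    refine (pow_le_pow_left₀ (norm_nonneg _) (norm_sum_le _ _) 2).trans ?_
    simpa using sq_sum_le_card_mul_sum_sq (s := Finset.range N) (f := fun n => ‖z n‖)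
  calc ((N : ℝ)⁻¹) ^ 2 * ‖∑ n ∈ Finset.range N, z n‖ ^ 2
      ≤ ((N : ℝ)⁻¹) ^ 2 * (N * ∑ n ∈ Finset.range N, ‖z n‖ ^ 2) := by gcongr
    _ = (N : ℝ)⁻¹ * ∑ n ∈ Finset.range N, ‖z n‖ ^ 2 := by field_simp

/-- The two sums differ only in `h` terms at each end. -/
theorem tendsto_cesaroMean_shift_sub {z : ℕ → ℂ} {C : ℝ} (hz : ∀ n, ‖z n‖ ≤ C) (h : ℕ) :
    Tendsto (fun N => cesaroMean (fun n => z (n + h)) N - cesaroMean z N) atTop (𝓝 0) := by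
  have key : ∀ N, ‖cesaroMean (fun n => z (n + h)) N - cesaroMean z N‖ ≤ (2 * h * C) / N := by
    intro N
    have e : ∑ n ∈ Finset.range N, z (n + h) - ∑ n ∈ Finset.range N, z n
        = ∑ i ∈ Finset.range h, z (N + i) - ∑ i ∈ Finset.range h, z i := by
      have e1 := Finset.sum_range_add z h N
      have e2 := Finset.sum_range_add z N h
      rw [add_comm h N, e2] at e1
      simp only [add_comm h] at e1
      linear_combination -e1
    have b1 : ‖∑ i ∈ Finset.range h, z (N + i)‖ ≤ h * C := by
      simpa using norm_sum_le_of_le (Finset.range h) (fun i _ => hz (N + i))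
    have b2 : ‖∑ i ∈ Finset.range h, z i‖ ≤ h * C := by
      simpa using norm_sum_le_of_le (Finset.range h) (fun i _ => hz i)
    simp only [cesaroMean]
    rw [← mul_sub, e, norm_mul, norm_inv, Complex.norm_natCast, inv_mul_eq_div]
    gcongr
    linarith [norm_sub_le (∑ i ∈ Finset.range h, z (N + i)) (∑ i ∈ Finset.range h, z i)]
  exact squeeze_zero_norm key (tendsto_const_div_atTop_nhds_zero_nat _)

theorem tendsto_cesaroMean_shift {z : ℕ → ℂ} {C : ℝ} (hz : ∀ n, ‖z n‖ ≤ C) (h : ℕ)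
    (hlim : Tendsto (cesaroMean z) atTop (𝓝 0)) :
    Tendsto (cesaroMean fun n => z (n + h)) atTop (𝓝 0) := by
  simpa using (tendsto_cesaroMean_shift_sub hz h).add hlim

/-- **Van der Corput's difference theorem**, in terms of means of bounded sequences. -/
theorem tendsto_cesaroMean_of_vanDerCorput {z : ℕ → ℂ} (hz : ∀ n, ‖z n‖ ≤ 1)
    (hcor : ∀ h, 1 ≤ h → Tendsto (cesaroMean fun n => z (n + h) * conj (z n)) atTop (𝓝 0)) :
    Tendsto (cesaroMean z) atTop (𝓝 0) := by
  have hpair : ∀ i j, ‖z i * conj (z j)‖ ≤ 1 := fun i j => by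
    rw [norm_mul, RCLike.norm_conj]
    exact mul_le_one₀ (hz i) (norm_nonneg _) (hz j)
  have hlt : ∀ i j, j < i →
      Tendsto (cesaroMean fun n => z (n + i) * conj (z (n + j))) atTop (𝓝 0) := by
    intro i j hij
    have := tendsto_cesaroMean_shift (fun n => hpair (n + (i - j)) n) j (hcor (i - j) (by omega))
    simpa [add_assoc, Nat.add_sub_cancel' hij.le] using this
  have hne : ∀ i j, i ≠ j →
      Tendsto (cesaroMean fun n => z (n + i) * conj (z (n + j))) atTop (𝓝 0) := by
    intro i j hij
    rcases lt_or_gt_of_ne hij with h | h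
    · have := (Complex.continuous_conj.tendsto 0).comp (hlt j i h)
      rw [map_zero] at this
      refine this.congr fun N => ?_
      simp [← cesaroMean_conj, mul_comm]
    · exact hlt i j h
  -- Up to `o(1)`, `H` times the mean of `z` is the mean of the window sums `S`. By Cauchy–Schwarz
  -- the latter is controlled by the correlations of shifts: off-diagonal ones vanish in the limit,
  -- and the `H` diagonal ones are at most 1. Each `+ 1` absorbs an `o(1)`.
  have main : ∀ H : ℕ, 1 ≤ H → ∀ᶠ N in atTop, H * ‖cesaroMean z N‖ ≤ √(H + 1) + 1 := by
    intro H hH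
    let S : ℕ → ℂ := fun n => ∑ h ∈ Finset.range H, z (n + h)
    have hS : Tendsto (fun N => cesaroMean S N - H * cesaroMean z N) atTop (𝓝 0) := by
      have := tendsto_finsetSum (Finset.range H)
        (fun h _ => tendsto_cesaroMean_shift_sub hz h)
      simpa [S, cesaroMean_finset_sum, Finset.sum_sub_distrib] using this
    have hSS : Tendsto (fun N => ∑ p ∈ (Finset.range H ×ˢ Finset.range H) with p.1 ≠ p.2,
        cesaroMean (fun n => z (n + p.1) * conj (z (n + p.2))) N) atTop (𝓝 0) := by
      have := tendsto_finsetSum ((Finset.range H ×ˢ Finset.range H).filter fun p => p.1 ≠ p.2)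
        (fun p hp => hne p.1 p.2 (Finset.mem_filter.1 hp).2)
      simpa using this
    have hdiag : ∀ N, ‖∑ p ∈ (Finset.range H ×ˢ Finset.range H) with ¬ p.1 ≠ p.2,
        cesaroMean (fun n => z (n + p.1) * conj (z (n + p.2))) N‖ ≤ H := by
      intro N
      have hc : ((Finset.range H ×ˢ Finset.range H).filter fun p => ¬ p.1 ≠ p.2).card = H := by
        have : ((Finset.range H ×ˢ Finset.range H).filter fun p => ¬ p.1 ≠ p.2)
            = (Finset.range H).diag := by
          ext p; simp [Finset.mem_diag]; grind
        rw [this, Finset.diag_card, Finset.card_range]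
      have := norm_sum_le_of_le ((Finset.range H ×ˢ Finset.range H).filter fun p => ¬ p.1 ≠ p.2)
        (fun p _ => norm_cesaroMean_le zero_le_one (fun n => hpair (n + p.1) (n + p.2)) N)
      simpa only [Finset.sum_const, hc, nsmul_eq_mul, mul_one] using this
    filter_upwards [hS.norm.eventually (gt_mem_nhds (by simp : ‖(0 : ℂ)‖ < 1)),
      hSS.norm.eventually (gt_mem_nhds (by simp : ‖(0 : ℂ)‖ < 1))] with N h1 h2
    have hexp : cesaroMean (fun n => S n * conj (S n)) N
        = ∑ p ∈ Finset.range H ×ˢ Finset.range H,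
          cesaroMean (fun n => z (n + p.1) * conj (z (n + p.2))) N := by
      rw [← cesaroMean_finset_sum]
      congr 1
      ext n
      simp only [S, map_sum]
      rw [Finset.sum_mul_sum, Finset.sum_product]
    have hsq : ‖cesaroMean S N‖ ^ 2 ≤ H + 1 := by
      refine (norm_cesaroMean_sq_le S N).trans ?_
      rw [hexp, ← Finset.sum_filter_add_sum_filter_not _ (fun p : ℕ × ℕ => p.1 ≠ p.2)]
      refine (norm_add_le _ _).trans ?_
      linarith [hdiag N]
    have h3 : ‖cesaroMean S N‖ ≤ √(H + 1) := Real.le_sqrt_of_sq_le hsq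
    have h4 : ‖(H : ℂ) * cesaroMean z N‖ = H * ‖cesaroMean z N‖ := by simp
    have h5 := norm_sub_norm_le ((H : ℂ) * cesaroMean z N) (cesaroMean S N)
    rw [norm_sub_rev] at h5
    linarith
  rw [Metric.tendsto_nhds]
  intro ε hε
  obtain ⟨K, hK⟩ := exists_nat_gt (3 / ε)
  have hK0 : (0 : ℝ) < K := (by positivity : (0 : ℝ) < 3 / ε).trans hK
  have hK1 : 1 ≤ K := by exact_mod_cast hK0
  -- With `H = K ^ 2` the bound on the mean is at most `(K + 2) / K ^ 2 ≤ 3 / K < ε`.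
  filter_upwards [main (K ^ 2) (Nat.one_le_pow _ _ hK1)] with N hN
  rw [dist_zero_right]
  have hK1' : (1 : ℝ) ≤ K := by exact_mod_cast hK1
  have hs : √((K ^ 2 : ℕ) + 1 : ℝ) ≤ K + 1 := by
    rw [Real.sqrt_le_left (by linarith)]
    push_cast
    nlinarith
  rw [div_lt_iff₀ hε] at hK
  by_contra! hcon
  have h6 : (K : ℝ) ^ 2 * ε ≤ (K : ℝ) ^ 2 * ‖cesaroMean z N‖ := by gcongr
  push_cast at hN hs
  nlinarith

/-! ### Weyl's theorem on polynomial exponential sums -/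

/-- The additive character `x ↦ exp (2 π i x)` of `ℝ`. -/
noncomputable def expTwoPi (x : ℝ) : ℂ := Complex.exp (2 * Real.pi * Complex.I * x)

theorem expTwoPi_add (x y : ℝ) : expTwoPi (x + y) = expTwoPi x * expTwoPi y := by
  simp [expTwoPi, ← Complex.exp_add, mul_add]

theorem norm_expTwoPi (x : ℝ) : ‖expTwoPi x‖ = 1 := by
  rw [expTwoPi, ← Complex.norm_exp_ofReal_mul_I (2 * Real.pi * x)]
  push_cast
  ring_nf

theorem conj_expTwoPi (x : ℝ) : conj (expTwoPi x) = expTwoPi (-x) := by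
  rw [expTwoPi, expTwoPi, ← Complex.exp_conj]
  simp [Complex.conj_ofNat]

theorem expTwoPi_ne_one {x : ℝ} (hx : Irrational x) : expTwoPi x ≠ 1 := by
  rw [expTwoPi, Ne, Complex.exp_eq_one_iff]
  rintro ⟨n, hn⟩
  have h2 : (2 * Real.pi * Complex.I : ℂ) ≠ 0 := Complex.two_pi_I_ne_zero
  rw [mul_comm, mul_left_inj' h2] at hn
  exact hx.ne_int n (by exact_mod_cast hn)

theorem expTwoPi_natCast_mul (n : ℕ) (x : ℝ) : expTwoPi (n * x) = expTwoPi x ^ n := by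
  rw [expTwoPi, expTwoPi, ← Complex.exp_nat_mul]
  push_cast
  ring_nf

theorem tendsto_cesaroMean_pow {w : ℂ} (hw : ‖w‖ = 1) (hw1 : w ≠ 1) :
    Tendsto (cesaroMean fun n => w ^ n) atTop (𝓝 0) := by
  have key : ∀ N, ‖cesaroMean (fun n => w ^ n) N‖ ≤ (2 / ‖w - 1‖) / N := by
    intro N
    rw [cesaroMean, norm_mul, norm_inv, Complex.norm_natCast, inv_mul_eq_div, geom_sum_eq hw1,
      norm_div]
    gcongr
    refine (norm_sub_le _ _).trans ?_
    simp [hw]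
    norm_num
  exact squeeze_zero_norm key (tendsto_const_div_atTop_nhds_zero_nat _)

theorem natDegree_taylor_sub_self_le {Q : ℝ[X]} {d : ℕ} (hQ : Q.natDegree ≤ d + 1) (r : ℝ) :
    (taylor r Q - Q).natDegree ≤ d := by
  rw [natDegree_le_iff_coeff_eq_zero]
  intro N hN
  rcases Nat.lt_or_ge Q.natDegree N with h | h
  · rw [coeff_sub, coeff_eq_zero_of_natDegree_lt (by simpa using h),
      coeff_eq_zero_of_natDegree_lt h, sub_zero]
  · have : Q.natDegree = N := by omega
    subst this
    rw [coeff_sub, coeff_taylor_natDegree, coeff_natDegree, sub_self]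

/-- Differencing keeps the top coefficient irrational when `r` is a positive integer, which drives
the induction in Weyl's theorem. -/
theorem coeff_taylor_sub_self {Q : ℝ[X]} {d : ℕ} (hQ : Q.natDegree ≤ d + 1) (r : ℝ) :
    (taylor r Q - Q).coeff d = (d + 1) * Q.coeff (d + 1) * r := by
  have hdeg : (hasseDeriv d Q).natDegree < 2 := by
    have := natDegree_hasseDeriv_le Q d
    omega
  rw [coeff_sub, taylor_coeff, eval_eq_sum_range' hdeg]
  simp [Finset.sum_range_succ, hasseDeriv_coeff, add_comm 1 d]

theorem tendsto_cesaroMean_expTwoPi_of_natDegree_le (d : ℕ) : ∀ Q : ℝ[X],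
    Q.natDegree ≤ d + 1 → Irrational (Q.coeff (d + 1)) →
      Tendsto (cesaroMean fun n => expTwoPi (Q.eval (n : ℝ))) atTop (𝓝 0) := by
  induction d with
  | zero =>
    intro Q hQ hirr
    have hfun : ∀ n : ℕ, expTwoPi (Q.eval (n : ℝ))
        = expTwoPi (Q.coeff 0) * expTwoPi (Q.coeff 1) ^ n := by
      intro n
      rw [← expTwoPi_natCast_mul, ← expTwoPi_add, eval_eq_sum_range' (Nat.lt_succ_of_le hQ)]
      simp [Finset.sum_range_succ, mul_comm]
    simp only [hfun]
    have := (tendsto_cesaroMean_pow (norm_expTwoPi _) (expTwoPi_ne_one hirr)).const_mul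
      (expTwoPi (Q.coeff 0))
    rw [mul_zero] at this
    exact this.congr fun N => (cesaroMean_const_mul _ _ N).symm
  | succ d ih =>
    intro Q hQ hirr
    refine tendsto_cesaroMean_of_vanDerCorput (fun n => (norm_expTwoPi _).le) fun h hh => ?_
    have := ih (taylor (h : ℝ) Q - Q) (natDegree_taylor_sub_self_le hQ _) (by
      rw [coeff_taylor_sub_self hQ]
      have h1 := (hirr.natCast_mul (m := d + 2) (by omega)).mul_natCast (m := h) (by omega)
      convert h1 using 2
      push_cast
      ring)
    refine this.congr fun N => ?_
    congr 1
    ext n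
    rw [conj_expTwoPi, ← expTwoPi_add, eval_sub, taylor_eval, sub_eq_add_neg, Nat.cast_add]

/-- **Weyl's theorem**: if the leading coefficient of a nonconstant polynomial `Q` is irrational,
then the means of `exp (2 π i Q(n))` tend to zero. -/
theorem tendsto_cesaroMean_expTwoPi {Q : ℝ[X]} (hdeg : Q.natDegree ≠ 0)
    (hirr : Irrational Q.leadingCoeff) :
    Tendsto (cesaroMean fun n => expTwoPi (Q.eval (n : ℝ))) atTop (𝓝 0) := by
  obtain ⟨d, hd⟩ := Nat.exists_eq_succ_of_ne_zero hdeg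
  refine tendsto_cesaroMean_expTwoPi_of_natDegree_le d Q hd.le ?_
  rwa [← Nat.succ_eq_add_one, ← hd]

/-! ### Density of sequences on a torus -/

open UnitAddTorus in
theorem mFourier_apply_add {ι : Type*} [Fintype ι] (m : ι → ℤ) (x y : UnitAddTorus ι) :
    mFourier m (x + y) = mFourier m x * mFourier m y := by
  simp only [mFourier, ContinuousMap.coe_mk, ← Finset.prod_mul_distrib, fourier_apply,
    Pi.add_apply, smul_add, AddCircle.toCircle_add, Circle.coe_mul]

open UnitAddTorus in
theorem mFourier_apply_sub_of_eq_one {ι : Type*} [Fintype ι] {m : ι → ℤ} {q : UnitAddTorus ι}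
    (hq : mFourier m q = 1) (x : UnitAddTorus ι) : mFourier m (x - q) = mFourier m x := by
  rw [← sub_add_cancel x q, mFourier_apply_add, hq, mul_one, sub_add_cancel]

open UnitAddTorus in
/-- Means along `u` are invariant under translation by `q` when `q` lies in the kernel of every
character whose mean along `u` does not vanish. -/
theorem tendsto_cesaroMean_translate_sub {ι : Type*} [Fintype ι] {u : ℕ → UnitAddTorus ι}
    {q : UnitAddTorus ι}
    (h : ∀ m : ι → ℤ, Tendsto (cesaroMean fun n => mFourier m (u n)) atTop (𝓝 0) ∨
      mFourier m q = 1)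
    (f : C(UnitAddTorus ι, ℂ)) :
    Tendsto (cesaroMean fun n => f (u n - q) - f (u n)) atTop (𝓝 0) := by
  have hspan : ∀ g ∈ Submodule.span ℂ (Set.range (mFourier (d := ι))),
      Tendsto (cesaroMean fun n => g (u n - q) - g (u n)) atTop (𝓝 0) := by
    intro g hg
    induction hg using Submodule.span_induction with
    | mem g hg =>
      obtain ⟨m, rfl⟩ := hg
      rcases h m with hm | hm
      -- Translation only multiplies the mean of a character by a constant.
      · have := (hm.mul_const (mFourier m (-q))).sub hm
        simp only [zero_mul, sub_zero] at this
        refine this.congr fun N => ?_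
        rw [cesaroMean_sub, mul_comm, ← cesaroMean_const_mul]
        simp only [sub_eq_add_neg, mFourier_apply_add, mul_comm]
      · simp [mFourier_apply_sub_of_eq_one hm, cesaroMean_zero]
    | zero => simp [cesaroMean_zero]
    | add g₁ g₂ _ _ h₁ h₂ =>
      have := h₁.add h₂
      rw [add_zero] at this
      refine this.congr fun N => ?_
      rw [← cesaroMean_add]
      congr 1
      ext n
      simp only [ContinuousMap.add_apply]
      ring
    | smul c g _ hg =>
      have := hg.const_mul c
      rw [mul_zero] at this
      refine this.congr fun N => ?_
      rw [← cesaroMean_const_mul]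
      congr 1
      ext n
      simp only [ContinuousMap.smul_apply, smul_eq_mul]
      ring
  rw [Metric.tendsto_nhds]
  intro ε hε
  have hf : f ∈ (Submodule.span ℂ (Set.range (mFourier (d := ι)))).topologicalClosure := by
    rw [span_mFourier_closure_eq_top]; trivial
  obtain ⟨g, hg, hfg⟩ := Metric.mem_closure_iff.1 hf (ε / 4) (by positivity)
  rw [dist_eq_norm] at hfg
  filter_upwards [(Metric.tendsto_nhds.1 (hspan g hg)) (ε / 4) (by positivity)] with N hN
  rw [dist_zero_right] at hN ⊢
  have hb : ‖cesaroMean (fun n => (f - g) (u n - q) - (f - g) (u n)) N‖ ≤ ε / 4 + ε / 4 := by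
    refine norm_cesaroMean_le (by positivity) (fun n => ?_) N
    refine (norm_sub_le _ _).trans (add_le_add ?_ ?_) <;>
      exact ((f - g).norm_coe_le_norm _).trans hfg.le
  have he : cesaroMean (fun n => f (u n - q) - f (u n)) N
      = cesaroMean (fun n => (f - g) (u n - q) - (f - g) (u n)) N
        + cesaroMean (fun n => g (u n - q) - g (u n)) N := by
    rw [← cesaroMean_add]
    congr 1
    ext n
    simp only [ContinuousMap.sub_apply]
    ring
  rw [he]
  linarith [norm_add_le (cesaroMean (fun n => (f - g) (u n - q) - (f - g) (u n)) N)
    (cesaroMean (fun n => g (u n - q) - g (u n)) N)]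

theorem le_norm_cesaroMean_ofReal {a : ℕ → ℝ} {c : ℝ} (hc : 0 ≤ c) (ha : ∀ n, c ≤ a n) {N : ℕ}
    (hN : 0 < N) : c ≤ ‖cesaroMean (fun n => (a n : ℂ)) N‖ := by
  have hN' : (0 : ℝ) < N := by exact_mod_cast hN
  have hs : N * c ≤ ∑ n ∈ Finset.range N, a n := by
    simpa using Finset.card_nsmul_le_sum (Finset.range N) a c (fun n _ => ha n)
  rw [cesaroMean, ← Complex.ofReal_sum, norm_mul, norm_inv, Complex.norm_natCast,
    Complex.norm_real, Real.norm_of_nonneg ((by positivity : 0 ≤ N * c).trans hs),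
    le_inv_mul_iff₀ hN']
  exact hs

open UnitAddTorus in
/-- If every character either has vanishing mean along `u`, or is trivial at `p` and along `u`,
then `p` is a limit of values of `u`. -/
theorem mem_closure_range_of_mFourier {ι : Type*} [Fintype ι] {u : ℕ → UnitAddTorus ι}
    {p : UnitAddTorus ι}
    (h : ∀ m : ι → ℤ, Tendsto (cesaroMean fun n => mFourier m (u n)) atTop (𝓝 0) ∨
      (mFourier m p = 1 ∧ ∀ k, mFourier m (u k) = 1)) :
    p ∈ closure (Set.range u) := by
  by_contra hp
  rw [Metric.mem_closure_range_iff] at hp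
  push Not at hp
  obtain ⟨ε, hε, hp⟩ := hp
  -- A bump supported in the `ε`-ball. Its translate by `p` vanishes along `u`, so by invariance its
  -- translates by every `u k` have mean zero. But finitely many of these add up to at least `ε / 2`
  -- on the whole range of `u`.
  let b : UnitAddTorus ι → ℝ := fun x => max 0 (ε - ‖x‖)
  let f : C(UnitAddTorus ι, ℂ) := ⟨fun x => (b x : ℂ), by fun_prop⟩
  have h0 : Tendsto (cesaroMean fun n => f (u n)) atTop (𝓝 0) := by
    have := (tendsto_cesaroMean_translate_sub (fun m => (h m).imp_right And.left) f).neg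
    rw [neg_zero] at this
    refine this.congr fun N => ?_
    rw [cesaroMean_sub]
    have hz : ∀ n, f (u n - p) = 0 := by
      intro n
      have : ε - ‖u n - p‖ ≤ 0 := by
        rw [← dist_eq_norm, dist_comm]
        linarith [hp n]
      simp [f, b, this]
    simp [hz, cesaroMean_zero]
  have hk : ∀ k, Tendsto (cesaroMean fun n => f (u n - u k)) atTop (𝓝 0) := by
    intro k
    have := (tendsto_cesaroMean_translate_sub (q := u k)
      (fun m => (h m).imp_right fun hm => hm.2 k) f).add h0
    rw [add_zero] at this
    refine this.congr fun N => ?_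
    rw [cesaroMean_sub, sub_add_cancel]
  obtain ⟨t, htu, htfin, ht⟩ := Metric.finite_approx_of_totallyBounded
    (isCompact_univ.totallyBounded.subset (Set.subset_univ (Set.range u))) (ε / 2) (by positivity)
  have hsum := tendsto_finsetSum htfin.toFinset (fun y hy => by
    obtain ⟨k, rfl⟩ := htu (htfin.mem_toFinset.1 hy)
    exact hk k : ∀ y ∈ htfin.toFinset, Tendsto (cesaroMean fun n => f (u n - y)) atTop (𝓝 0))
  simp only [Finset.sum_const_zero] at hsum
  have hlow : ∀ n, ε / 2 ≤ ∑ y ∈ htfin.toFinset, b (u n - y) := by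
    intro n
    obtain ⟨y, hy, hny⟩ := Set.mem_iUnion₂.1 (ht ⟨n, rfl⟩)
    rw [Metric.mem_ball, dist_eq_norm] at hny
    refine le_trans ?_ (Finset.single_le_sum (fun y _ => le_max_left _ _)
      (htfin.mem_toFinset.2 hy))
    exact le_trans (by linarith) (le_max_right _ _)
  obtain ⟨N, hN, hN0⟩ := ((Metric.tendsto_nhds.1 hsum (ε / 2) (by positivity)).and
    (eventually_gt_atTop 0)).exists
  rw [dist_zero_right, ← cesaroMean_finset_sum] at hN
  have := le_norm_cesaroMean_ofReal (by positivity) hlow hN0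
  simp only [Complex.ofReal_sum] at this
  exact absurd hN (not_lt.2 this)

/-! ### Simultaneous approximation of polynomial values modulo one -/

open UnitAddTorus in
theorem mFourier_coe_eq_expTwoPi {ι : Type*} [Fintype ι] (m : ι → ℤ) (x : ι → ℝ) :
    mFourier m (fun i => (x i : UnitAddCircle)) = expTwoPi (∑ i, m i * x i) := by
  simp only [mFourier, ContinuousMap.coe_mk, fourier_coe_apply, expTwoPi]
  rw [← Complex.exp_sum]
  congr 1
  push_cast
  rw [Finset.mul_sum]
  refine Finset.sum_congr rfl fun i _ => ?_
  ring

open UnitAddTorus in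
/-- If the coefficients of the polynomials `Q i` (without constant term) lie in a subgroup of `ℝ`
that meets `ℚ` only in `0`, then the values of `(Q i)_i` at positive multiples of `D` are, modulo
one, dense on the curve of values of `(Q i)_i` at all real numbers. -/
theorem eval_mem_closure_range {ι : Type*} [Fintype ι] {B : AddSubgroup ℝ}
    (hB : ∀ b ∈ B, b = 0 ∨ Irrational b) {Q : ι → ℝ[X]} (hQB : ∀ i k, (Q i).coeff k ∈ B)
    (hQ0 : ∀ i, (Q i).coeff 0 = 0) {D : ℕ} (hD : 0 < D) (t : ℝ) :
    (fun i => (((Q i).eval t : ℝ) : UnitAddCircle)) ∈ closure (Set.range fun n : ℕ =>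
      fun i => (((Q i).eval ((D * (n + 1) : ℕ) : ℝ) : ℝ) : UnitAddCircle)) := by
  refine mem_closure_range_of_mFourier fun m => ?_
  simp only [mFourier_coe_eq_expTwoPi]
  let R : ℝ[X] := ∑ i, C (m i : ℝ) * Q i
  have hR : ∀ x, ∑ i, (m i : ℝ) * (Q i).eval x = R.eval x := fun x => by
    simp [R, eval_finsetSum]
  have hRc : ∀ k, R.coeff k = ∑ i, (m i : ℝ) * (Q i).coeff k := fun k => by
    simp [R, finsetSum_coeff]
  have hRB : ∀ k, R.coeff k ∈ B := fun k => by
    rw [hRc]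
    refine B.sum_mem fun i _ => ?_
    rw [← zsmul_eq_mul]
    exact B.zsmul_mem (hQB i k) _
  simp only [hR]
  by_cases hzero : R = 0
  · right
    simp [hzero, expTwoPi]
  left
  have hD' : (D : ℝ) ≠ 0 := by exact_mod_cast hD.ne'
  have hdeg : R.natDegree ≠ 0 := fun h0 => hzero <| by
    rw [eq_C_of_natDegree_eq_zero h0, hRc]
    simp [hQ0]
  have hirr : Irrational R.leadingCoeff :=
    (hB _ (hRB _)).resolve_left (leadingCoeff_ne_zero.2 hzero)
  have hlin : (C (D : ℝ) * X).natDegree = 1 := natDegree_C_mul_X _ hD'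
  have hW := tendsto_cesaroMean_expTwoPi (Q := R.comp (C (D : ℝ) * X))
    (by rwa [natDegree_comp, hlin, mul_one]) (by
      rw [leadingCoeff_comp (by rw [hlin]; exact one_ne_zero), leadingCoeff_mul, leadingCoeff_C,
        leadingCoeff_X, mul_one, ← Nat.cast_pow]
      exact hirr.mul_natCast (pow_ne_zero _ hD.ne'))
  -- The shift by one discards the multiple `0` of `D`.
  have := tendsto_cesaroMean_shift (fun n => (norm_expTwoPi _).le) 1 hW
  simpa [eval_comp] using this

/-- `ℚ` is a direct summand of the `ℚ`-vector space `ℝ`. Linearity makes the kernel a subgroup,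
stable under the integer combinations that characters produce. -/
theorem exists_rational_part : ∃ f : ℝ →ₗ[ℚ] ℚ, ∀ q : ℚ, f q = q := by
  obtain ⟨f, hf⟩ := (Algebra.linearMap ℚ ℝ).exists_leftInverse_of_injective
    (LinearMap.ker_eq_bot.2 (algebraMap ℚ ℝ).injective)
  exact ⟨f, fun q => LinearMap.congr_fun hf q⟩

/-- The polynomial obtained from `P` by removing from each coefficient its rational part, as
measured by `f`. -/
noncomputable def irrationalPart (f : ℝ →ₗ[ℚ] ℚ) (P : ℝ[X]) : ℝ[X] :=
  ∑ i ∈ Finset.range (P.natDegree + 1), monomial i (P.coeff i - f (P.coeff i))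

theorem coeff_irrationalPart (f : ℝ →ₗ[ℚ] ℚ) (P : ℝ[X]) (k : ℕ) :
    (irrationalPart f P).coeff k = P.coeff k - f (P.coeff k) := by
  simp only [irrationalPart, finsetSum_coeff, coeff_monomial, Finset.sum_ite_eq',
    Finset.mem_range]
  split_ifs with h
  · rfl
  · rw [coeff_eq_zero_of_natDegree_lt (by omega)]
    simp

/-- A polynomial with rational coefficients and no constant term is integer valued at the multiples
of some positive integer. -/
theorem exists_dvd_eval_eq_int {R : ℝ[X]} (h0 : R.coeff 0 = 0)
    (hR : ∀ k, ∃ q : ℚ, R.coeff k = q) :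
    ∃ D : ℕ, 0 < D ∧ ∀ n : ℕ, D ∣ n → ∃ a : ℤ, R.eval (n : ℝ) = a := by
  choose q hq using hR
  refine ⟨∏ k ∈ Finset.range (R.natDegree + 1), (q k).den,
    Finset.prod_pos fun k _ => (q k).den_pos, fun n hn => ?_⟩
  rw [eval_eq_sum_range]
  have hterm : ∀ k ∈ Finset.range (R.natDegree + 1), ∃ a : ℤ, R.coeff k * (n : ℝ) ^ k = a := by
    intro k hk
    rcases Nat.eq_zero_or_pos k with rfl | hk0
    · exact ⟨0, by simp [h0]⟩
    obtain ⟨c, hc⟩ := ((Finset.dvd_prod_of_mem (fun k => (q k).den) hk).trans hn).trans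
      (dvd_pow_self n hk0.ne')
    refine ⟨(q k).num * c, ?_⟩
    rw [hq, ← Nat.cast_pow, hc]
    have := Rat.mul_den_eq_num (q k)
    have h' : ((q k : ℚ) : ℝ) * (q k).den = (q k).num := by exact_mod_cast this
    push_cast
    rw [← mul_assoc, h']
  choose! a ha using hterm
  exact ⟨∑ k ∈ Finset.range (R.natDegree + 1), a k, by
    push_cast
    exact Finset.sum_congr rfl ha⟩

/-- For every real `t` there is a filter on the positive integers along which all polynomials
without constant term converge modulo one, to the values at `t` of their irrational parts. -/
theorem exists_filter_tendsto_eval {f : ℝ →ₗ[ℚ] ℚ} (hf : ∀ q : ℚ, f q = q) (t : ℝ) :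
    ∃ l : Filter ℕ, l.NeBot ∧ (∀ᶠ n in l, 1 ≤ n) ∧ ∀ P : ℝ[X], P.coeff 0 = 0 →
      Tendsto (fun n : ℕ => ((P.eval (n : ℝ) : ℝ) : UnitAddCircle)) l
        (𝓝 (((irrationalPart f P).eval t : ℝ) : UnitAddCircle)) := by
  classical
  -- The sets `A i` form a filter base: finite sets of polynomials, divisors and tolerances are
  -- refined by union, product and minimum. A filter serves all the uncountably many polynomials at
  -- once.
  let I := Finset {P : ℝ[X] // P.coeff 0 = 0} × {D : ℕ // 0 < D} × {ε : ℝ // 0 < ε}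
  let A : I → Set ℕ := fun i => {n | 1 ≤ n ∧ i.2.1.1 ∣ n ∧ ∀ P ∈ i.1,
    dist (((irrationalPart f P.1).eval (n : ℝ) : ℝ) : UnitAddCircle)
      (((irrationalPart f P.1).eval t : ℝ) : UnitAddCircle) < i.2.2.1}
  have : Nonempty I := ⟨(∅, ⟨1, one_pos⟩, ⟨1, one_pos⟩)⟩
  have hA : ∀ i, (A i).Nonempty := by
    rintro ⟨S, ⟨D, hD⟩, ⟨ε, hε⟩⟩
    have hmem := eval_mem_closure_range (B := f.toAddMonoidHom.ker)
      (Q := fun P : S => irrationalPart f P.1.1) (fun b hb => by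
        by_cases hb0 : b = 0
        · exact Or.inl hb0
        · refine Or.inr fun ⟨q, hq⟩ => hb0 ?_
          have h1 : f b = 0 := hb
          rw [← hq, hf] at h1
          rw [← hq, h1, Rat.cast_zero])
      (fun P k => by
        change f _ = 0
        rw [coeff_irrationalPart, map_sub, hf, sub_self])
      (fun P => by rw [coeff_irrationalPart, P.1.2]; simp) hD t
    obtain ⟨n, hn⟩ := Metric.mem_closure_range_iff.1 hmem ε hε
    refine ⟨D * (n + 1), Nat.mul_pos hD n.succ_pos, dvd_mul_right _ _, fun P hP => ?_⟩
    rw [dist_comm]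
    exact (dist_pi_lt_iff hε).1 hn ⟨P, hP⟩
  have hdir : Directed (· ≥ ·) fun i => 𝓟 (A i) := by
    rintro ⟨S₁, ⟨D₁, hD₁⟩, ⟨ε₁, hε₁⟩⟩ ⟨S₂, ⟨D₂, hD₂⟩, ⟨ε₂, hε₂⟩⟩
    refine ⟨(S₁ ∪ S₂, ⟨D₁ * D₂, Nat.mul_pos hD₁ hD₂⟩, ⟨min ε₁ ε₂, lt_min hε₁ hε₂⟩),
      principal_mono.2 ?_, principal_mono.2 ?_⟩
    · rintro n ⟨h1, h2, h3⟩
      exact ⟨h1, (dvd_mul_right _ _).trans h2, fun P hP =>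
        (h3 P (Finset.mem_union_left _ hP)).trans_le (min_le_left _ _)⟩
    · rintro n ⟨h1, h2, h3⟩
      exact ⟨h1, (dvd_mul_left _ _).trans h2, fun P hP =>
        (h3 P (Finset.mem_union_right _ hP)).trans_le (min_le_right _ _)⟩
  have hmem : ∀ i, A i ∈ ⨅ i, 𝓟 (A i) := fun i => mem_iInf_of_mem i (mem_principal_self _)
  refine ⟨⨅ i, 𝓟 (A i), iInf_neBot_of_directed' hdir fun i => principal_neBot_iff.2 (hA i), ?_, ?_⟩
  · filter_upwards [hmem (Classical.arbitrary I)] with n hn using hn.1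
  · intro P hP
    obtain ⟨D, hD, hDint⟩ := exists_dvd_eval_eq_int (R := P - irrationalPart f P)
      (by rw [coeff_sub, coeff_irrationalPart, hP]; simp)
      (fun k => ⟨f (P.coeff k), by rw [coeff_sub, coeff_irrationalPart, sub_sub_cancel]⟩)
    rw [Metric.tendsto_nhds]
    intro ε hε
    filter_upwards [hmem ({⟨P, hP⟩}, ⟨D, hD⟩, ⟨ε, hε⟩)] with n hn
    obtain ⟨a, ha⟩ := hDint n hn.2.1
    have he : ((P.eval (n : ℝ) : ℝ) : UnitAddCircle) = ((irrationalPart f P).eval (n : ℝ) : ℝ) := by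
      rw [← sub_eq_zero, ← AddCircle.coe_sub, ← eval_sub, ha, AddCircle.coe_eq_zero_iff]
      exact ⟨a, by simp⟩
    rw [he]
    exact hn.2.2 ⟨P, hP⟩ (Finset.mem_singleton_self _)

/-! ### Almost periodic perturbations -/

theorem fourier_one_coe (x : ℝ) : fourier 1 (x : UnitAddCircle)
    = (Real.cos (2 * Real.pi * x) : ℂ) + (Real.sin (2 * Real.pi * x) : ℂ) * Complex.I := by
  rw [fourier_coe_apply, Complex.ofReal_cos, Complex.ofReal_sin, ← Complex.exp_mul_I]
  congr 1
  push_cast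
  ring

theorem tendsto_cos_of_tendsto_coe {α : Type*} {l : Filter α} {x : α → ℝ} {y : ℝ}
    (h : Tendsto (fun n => (x n : UnitAddCircle)) l (𝓝 (y : UnitAddCircle))) :
    Tendsto (fun n => Real.cos (2 * Real.pi * x n)) l (𝓝 (Real.cos (2 * Real.pi * y))) := by
  have := (Complex.continuous_re.tendsto _).comp (((fourier 1).continuous.tendsto _).comp h)
  simpa only [Function.comp_def, fourier_one_coe, Complex.add_re, Complex.ofReal_re,
    Complex.re_ofReal_mul, Complex.I_re, mul_zero, add_zero] using this

theorem tendsto_sin_of_tendsto_coe {α : Type*} {l : Filter α} {x : α → ℝ} {y : ℝ}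
    (h : Tendsto (fun n => (x n : UnitAddCircle)) l (𝓝 (y : UnitAddCircle))) :
    Tendsto (fun n => Real.sin (2 * Real.pi * x n)) l (𝓝 (Real.sin (2 * Real.pi * y))) := by
  have := (Complex.continuous_im.tendsto _).comp (((fourier 1).continuous.tendsto _).comp h)
  simpa only [Function.comp_def, fourier_one_coe, Complex.add_im, Complex.ofReal_im,
    Complex.im_ofReal_mul, Complex.I_im, mul_one, zero_add] using this

/-- Along a filter on which polynomials converge modulo one to the values at `t` of their irrational
parts, a trigonometric polynomial in polynomials converges to the value at `t` of a bounded
continuous function. -/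
theorem exists_limit_of_mem_adjoin (f : ℝ →ₗ[ℚ] ℚ) {ν : ℕ} {P : Fin ν → ℝ[X]}
    (hP : ∀ j, (P j).coeff 0 = 0) {T : (Fin ν → ℝ) → ℝ}
    (hT : T ∈ Algebra.adjoin ℝ (trigMonomials ν)) :
    ∃ G : ℝ → ℝ, Continuous G ∧ (∃ C, ∀ t, |G t| ≤ C) ∧ ∀ (t : ℝ) (l : Filter ℕ),
      (∀ Q : ℝ[X], Q.coeff 0 = 0 → Tendsto (fun n : ℕ => ((Q.eval (n : ℝ) : ℝ) : UnitAddCircle)) l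
        (𝓝 (((irrationalPart f Q).eval t : ℝ) : UnitAddCircle))) →
      Tendsto (fun n : ℕ => T fun j => (P j).eval (n : ℝ)) l (𝓝 (G t)) := by
  induction hT using Algebra.adjoin_induction with
  | mem T hT =>
    obtain ⟨j, c, hT⟩ := hT
    -- The rescaling turns frequency `c` into period one. The irrational part must be taken of `Q`
    -- itself, since it does not commute with real scalars.
    let Q : ℝ[X] := C (c / (2 * Real.pi)) * P j
    have hQ : Q.coeff 0 = 0 := by simp [Q, hP j]
    have hcQ : ∀ x : ℝ, c * (P j).eval x = 2 * Real.pi * Q.eval x := fun x => by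
      simp only [Q, eval_mul, eval_C]
      field_simp
    rcases hT with rfl | rfl
    · refine ⟨fun t => Real.cos (2 * Real.pi * (irrationalPart f Q).eval t), by fun_prop,
        ⟨1, fun t => Real.abs_cos_le_one _⟩, fun t l hl => ?_⟩
      simp only [hcQ]
      exact tendsto_cos_of_tendsto_coe (hl Q hQ)
    · refine ⟨fun t => Real.sin (2 * Real.pi * (irrationalPart f Q).eval t), by fun_prop,
        ⟨1, fun t => Real.abs_sin_le_one _⟩, fun t l hl => ?_⟩
      simp only [hcQ]
      exact tendsto_sin_of_tendsto_coe (hl Q hQ)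
  | algebraMap r =>
    exact ⟨fun _ => r, continuous_const, ⟨|r|, fun _ => le_rfl⟩, fun _ _ _ => tendsto_const_nhds⟩
  | add S T _ _ hS hT =>
    obtain ⟨G, hG, ⟨A, hA⟩, hG'⟩ := hS
    obtain ⟨H, hH, ⟨B, hB⟩, hH'⟩ := hT
    exact ⟨fun t => G t + H t, hG.add hH,
      ⟨A + B, fun t => (abs_add_le _ _).trans (add_le_add (hA t) (hB t))⟩,
      fun t l hl => (hG' t l hl).add (hH' t l hl)⟩
  | mul S T _ _ hS hT =>
    obtain ⟨G, hG, ⟨A, hA⟩, hG'⟩ := hS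
    obtain ⟨H, hH, ⟨B, hB⟩, hH'⟩ := hT
    refine ⟨fun t => G t * H t, hG.mul hH, ⟨A * B, fun t => ?_⟩,
      fun t l hl => (hG' t l hl).mul (hH' t l hl)⟩
    rw [abs_mul]
    exact mul_le_mul (hA t) (hB t) (abs_nonneg _) ((abs_nonneg _).trans (hA t))

/-- A nonconstant real polynomial plus a bounded continuous function takes every value modulo
one. -/
theorem exists_eval_add_eq_add_int {R : ℝ[X]} (hR : 0 < R.degree) {G : ℝ → ℝ}
    (hG : Continuous G) {A : ℝ} (hA : ∀ t, |G t| ≤ A) (y : ℝ) :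
    ∃ (t : ℝ) (k : ℤ), R.eval t + G t = y + k := by
  let h : ℝ → ℝ := fun t => R.eval t + G t
  have hc : Continuous h := R.continuous.add hG
  -- The margin 2 puts `h s` more than one unit above or below `h 0`, so a point of `y + ℤ` lies
  -- between them.
  obtain ⟨s, hs⟩ := ((R.abs_tendsto_atTop hR).eventually_ge_atTop (|h 0| + 2 + A)).exists
  have hs' : |h 0| + 2 ≤ |h s| := by
    have h1 := abs_sub_abs_le_abs_sub (R.eval s) (-G s)
    rw [abs_neg, sub_neg_eq_add] at h1
    change |h 0| + 2 ≤ |R.eval s + G s|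
    linarith [hA s]
  have h1 := Int.le_ceil (h 0 - y)
  have h2 := Int.ceil_lt_add_one (h 0 - y)
  rcases abs_cases (h s) with ⟨he, _⟩ | ⟨he, _⟩
  · obtain ⟨t, ht⟩ := mem_range_of_exists_le_of_exists_ge hc (c := y + ⌈h 0 - y⌉)
      ⟨0, by linarith⟩ ⟨s, by linarith [le_abs_self (h 0)]⟩
    exact ⟨t, _, ht⟩
  · obtain ⟨t, ht⟩ := mem_range_of_exists_le_of_exists_ge hc (c := y + (⌈h 0 - y⌉ - 1 : ℤ))
      ⟨s, by push_cast; linarith [neg_abs_le (h 0)]⟩ ⟨0, by push_cast; linarith⟩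
    exact ⟨t, _, ht⟩

/-- Interior points `y` suffice, and an error below `min y (1 - y)` prevents wrapping around an
integer. -/
theorem denseModOne_of_forall_approx {u : ℕ → ℝ}
    (h : ∀ y ε : ℝ, 0 < ε → ∃ n, 1 ≤ n ∧ ∃ k : ℤ, |u n - (y + k)| < ε) : DenseModOne u := by
  refine Set.Ico_subset_Icc_self.trans ?_
  rw [← closure_Ioo (zero_ne_one (α := ℝ))]
  refine closure_minimal (fun y hy => ?_) isClosed_closure
  rw [Metric.mem_closure_iff]
  intro ε hε
  obtain ⟨n, hn, k, hk⟩ := h y (min ε (min y (1 - y)))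
    (lt_min hε (lt_min hy.1 (sub_pos.2 hy.2)))
  obtain ⟨h1, h2, h3⟩ : |u n - (y + k)| < ε ∧ |u n - (y + k)| < y ∧ |u n - (y + k)| < 1 - y := by
    simpa only [lt_min_iff] using hk
  have hfr : Int.fract (u n) = u n - k := by
    rw [← Int.fract_sub_intCast (u n) k]
    exact Int.fract_eq_self.2 ⟨by linarith [(abs_lt.1 h2).1], by linarith [(abs_lt.1 h3).2]⟩
  refine ⟨_, ⟨n, hn, rfl⟩, ?_⟩
  simp only [hfr]
  rw [dist_comm, Real.dist_eq]
  convert h1 using 2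
  ring

theorem denseModOne_eval_add_of_isAlmostPeriodic {ν : ℕ} {P₀ : ℝ[X]} {P : Fin ν → ℝ[X]}
    (hP₀ : P₀.coeff 0 = 0) (hP : ∀ j, (P j).coeff 0 = 0)
    (hirr : ∃ k : ℕ, Irrational (P₀.coeff k)) {F : (Fin ν → ℝ) → ℝ} (hF : IsAlmostPeriodic F) :
    DenseModOne (fun n => P₀.eval (n : ℝ) + F (fun j => (P j).eval (n : ℝ))) := by
  obtain ⟨f, hf⟩ := exists_rational_part
  have hdeg : 0 < (irrationalPart f P₀).degree := by
    obtain ⟨k, hk⟩ := hirr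
    have hk0 : k ≠ 0 := by
      rintro rfl
      exact hk ⟨0, by simp [hP₀]⟩
    rw [← natDegree_pos_iff_degree_pos]
    refine (Nat.pos_of_ne_zero hk0).trans_le (le_natDegree_of_ne_zero ?_)
    rw [coeff_irrationalPart, sub_ne_zero]
    exact hk.ne_rat _
  refine denseModOne_of_forall_approx fun y ε hε => ?_
  obtain ⟨T, hT, hFT⟩ := hF (ε / 3) (by positivity)
  obtain ⟨G, hG, ⟨A, hA⟩, hlim⟩ := exists_limit_of_mem_adjoin f hP hT
  obtain ⟨t, k, htk⟩ := exists_eval_add_eq_add_int hdeg hG hA y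
  obtain ⟨l, hl, hl1, hlP⟩ := exists_filter_tendsto_eval hf t
  obtain ⟨n, hn1, hnP, hnT⟩ := (hl1.and (((Metric.tendsto_nhds.1 (hlP P₀ hP₀)) (ε / 3)
    (by positivity)).and ((Metric.tendsto_nhds.1 (hlim t l hlP)) (ε / 3) (by positivity)))).exists
  rw [dist_eq_norm, ← AddCircle.coe_sub, UnitAddCircle.norm_eq] at hnP
  rw [Real.dist_eq] at hnT
  have hFn := hFT fun j => (P j).eval (n : ℝ)
  -- The norm on `UnitAddCircle` is the distance to the nearest integer, so `round` undoes the
  -- reduction modulo one.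
  refine ⟨n, hn1, k + round (P₀.eval (n : ℝ) - (irrationalPart f P₀).eval t), ?_⟩
  push_cast
  rw [abs_lt] at hnP hnT ⊢
  rw [abs_le] at hFn
  constructor <;> linarith [hnP.1, hnP.2, hnT.1, hnT.2, hFn.1, hFn.2]

theorem IsAlmostPeriodicOneVar.isAlmostPeriodic_sum {ν : ℕ} {f : Fin ν → ℝ → ℝ}
    (hf : ∀ j, IsAlmostPeriodicOneVar (f j)) :
    IsAlmostPeriodic (fun x : Fin ν → ℝ => ∑ j, f j (x j)) := by
  intro ε hε
  -- Dividing by `ν + 1` rather than `ν` covers `ν = 0`.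
  choose N a b c h using fun j => hf j (ε / (ν + 1)) (by positivity)
  refine ⟨∑ j, ∑ k, (a j k • (fun x : Fin ν → ℝ => Real.cos (c j k * x j))
      + b j k • (fun x : Fin ν → ℝ => Real.sin (c j k * x j))), ?_, fun x => ?_⟩
  · have hcos : ∀ j k, (fun x : Fin ν → ℝ => Real.cos (c j k * x j)) ∈ trigMonomials ν :=
      fun j k => ⟨j, c j k, Or.inl rfl⟩
    have hsin : ∀ j k, (fun x : Fin ν → ℝ => Real.sin (c j k * x j)) ∈ trigMonomials ν :=
      fun j k => ⟨j, c j k, Or.inr rfl⟩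
    exact sum_mem fun j _ => sum_mem fun k _ => add_mem
      (Subalgebra.smul_mem _ (Algebra.subset_adjoin (hcos j k)) _)
      (Subalgebra.smul_mem _ (Algebra.subset_adjoin (hsin j k)) _)
  · simp only [Finset.sum_apply, Pi.add_apply, Pi.smul_apply, smul_eq_mul]
    rw [← Finset.sum_sub_distrib]
    refine (Finset.abs_sum_le_sum_abs _ _).trans ((Finset.sum_le_sum fun j _ => h j (x j)).trans ?_)
    rw [Finset.sum_const, Finset.card_univ, Fintype.card_fin, nsmul_eq_mul, mul_div_assoc',
      div_le_iff₀ (by positivity)]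
    linarith

theorem mainTheorem8 (ν : ℕ) (P₀ : ℝ[X]) (P : Fin ν → ℝ[X])
    (hP₀ : P₀.coeff 0 = 0) (hP : ∀ j, (P j).coeff 0 = 0)
    (hirr : ∃ k : ℕ, Irrational (P₀.coeff k)) :
    (∀ F : (Fin ν → ℝ) → ℝ, IsAlmostPeriodic F →
      DenseModOne (fun n => P₀.eval (n : ℝ) + F (fun j => (P j).eval (n : ℝ)))) ∧
    (∀ f : Fin ν → ℝ → ℝ, (∀ j, IsAlmostPeriodicOneVar (f j)) →
      DenseModOne (fun n => P₀.eval (n : ℝ) + ∑ j, f j ((P j).eval (n : ℝ)))) :=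
  ⟨fun _ hF => denseModOne_eval_add_of_isAlmostPeriodic hP₀ hP hirr hF,
    fun _ hf => denseModOne_eval_add_of_isAlmostPeriodic hP₀ hP hirr
      (IsAlmostPeriodicOneVar.isAlmostPeriodic_sum hf)⟩
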